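/- All graphs are finite, undirected and simple (no loops or multiple edges), and the empty graph is allowed. A graph $G$ embeds in a graph $H$ if $G$ is isomorphic to an induced subgraph of $H$. A class of graphs is hereditary if it contains every graph that embeds in one of its members. A permutation graph is a graph isomorphic to one with vertex set $\{1,\dots,n\}$ whose edges are the pairs $\{i,j\}$ reversed by some permutation $\sigma$ of $\{1,\dots,n\}$ (that is, $i<j$ and $\sigma(i)>\sigma(j)$); a bipartite permutation graph is a permutation graph that is bipartite. Let $\mathcal C$ be a hereditary class of finite bipartite permutation graphs. A bound of $\mathcal C$ is a finite graph not in $\mathcal C$ all of whose proper induced subgraphs belong to $\mathcal C$. A quasi-ordered set is wqo if every infinite sequence of its elements contains an infinite increasing (i.e. non-decreasing) subsequence. For a quasi-ordered set $Q$, let $\mathcal C\cdot Q$ be the class of pairs $(G,f)$ with $G\in\mathcal C$ and $f:V(G)\to Q$, quasi-ordered by $(G,f)\le(G',f')$ if there is an isomorphism $h$ of $G$ onto an induced subgraph of $G'$ with $f(x)\le f'(h(x))$ for all $x\in V(G)$. The class $\mathcal C$ is hereditary wqo if $\mathcal C\cdot Q$ is wqo for every wqo $Q$. Let $\mathrm P_k$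 denote the path on $k$ vertices; $\mathcal C$ is $\mathrm P_k$-free if $\mathrm P_k\notin\mathcal C$. Then the following are equivalent: (i) $\mathcal C$ has, up to isomorphism, only finitely many bounds; (ii) $\mathcal C$ is hereditary wqo; (iii) $\mathcal C$ is $\mathrm P_k$-free for some nonnegative integer $k$. -/

import Mathlib

universe u v

/-- A finite (simple, undirected, loopless) graph. The empty graph is allowed. -/
structure FinGraph where
  V : Type u
  finite : Finite V
  graph : SimpleGraph V

attribute [instance] FinGraph.finite

/-- The finite graph induced on a set of vertices. -/
def FinGraph.induced (G : FinGraph.{u}) (s : Set G.V) : FinGraph.{u} where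
  V := s
  finite := inferInstance
  graph := G.graph.induce s

/-- `G ≤ H`: the graph `G` is isomorphic to an induced subgraph of `H`. -/
def FinGraph.Embeds (G H : FinGraph.{u}) : Prop :=
  Nonempty (G.graph ↪g H.graph)

/-- The graph of a permutation: vertices are the elements, edges are the pairs that are
reversed by the permutation. -/
def inversionGraph {n : ℕ} (σ : Equiv.Perm (Fin n)) : SimpleGraph (Fin n) where
  Adj i j := (i < j ∧ σ j < σ i) ∨ (j < i ∧ σ i < σ j)
  symm := ⟨fun _ _ h => h.symm⟩
  loopless := ⟨fun i h => by rcases h with h | h <;> exact lt_irrefl i h.1⟩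

/-- A finite permutation graph: a graph isomorphic to the graph of some permutation. -/
def FinGraph.IsPermutationGraph (G : FinGraph.{u}) : Prop :=
  ∃ (n : ℕ) (σ : Equiv.Perm (Fin n)), Nonempty (G.graph ≃g inversionGraph σ)

/-- A finite bipartite permutation graph. -/
def FinGraph.IsBipartitePermutationGraph (G : FinGraph.{u}) : Prop :=
  G.graph.IsBipartite ∧ G.IsPermutationGraph

/-- A class of finite graphs is hereditary if it contains every finite graph that embeds into
one of its members. In particular it is closed under isomorphism. -/
def IsHereditaryClass (C : Set FinGraph.{u}) : Prop :=
  ∀ G H : FinGraph.{u}, H ∈ C → G.Embeds H → G ∈ C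

/-- A bound of a class `C` of finite graphs: a finite graph not in `C`, all of whose proper
induced subgraphs are in `C`. -/
def IsBoundOf (C : Set FinGraph.{u}) (B : FinGraph.{u}) : Prop :=
  B ∉ C ∧ ∀ s : Set B.V, s ≠ Set.univ → B.induced s ∈ C

/-- The class `C` has, up to isomorphism, only finitely many bounds. -/
def HasFinitelyManyBounds (C : Set FinGraph.{u}) : Prop :=
  ∃ S : Set FinGraph.{u}, S.Finite ∧
    ∀ B, IsBoundOf C B → ∃ B' ∈ S, Nonempty (B.graph ≃g B'.graph)

/-- A finite graph whose vertices are labelled by elements of `Q`. -/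
structure LabelledFinGraph (Q : Type v) extends FinGraph.{u} where
  label : V → Q

/-- The quasi-order on labelled graphs: an embedding under which labels do not decrease. -/
def LabelledFinGraph.Embeds {Q : Type v} [Preorder Q]
    (G H : LabelledFinGraph.{u, v} Q) : Prop :=
  ∃ h : G.graph ↪g H.graph, ∀ x, G.label x ≤ H.label (h x)

/-- `C` is hereditary wqo: for every wqo `Q`, the class of members of `C` labelled by `Q` is
well-quasi-ordered. -/
def IsHereditaryWqo (C : Set FinGraph.{u}) : Prop :=
  ∀ (Q : Type v) [Preorder Q] [WellQuasiOrderedLE Q],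
    {G : LabelledFinGraph.{u, v} Q | G.toFinGraph ∈ C}.PartiallyWellOrderedOn
      LabelledFinGraph.Embeds

/-- `C` is `P_k`-free: it does not contain the path on `k` vertices. -/
def IsPathFree (k : ℕ) (C : Set FinGraph.{u}) : Prop :=
  ∀ G ∈ C, ¬ Nonempty (G.graph ≃g SimpleGraph.pathGraph k)

/-! (iii) → (ii): In a connected bipartite permutation graph take the leftmost vertex `v` and the
distance levels from it. Neighbours lie on one side only, alternating with the level, so one of the
two orders `pos`, `val` decides adjacency between consecutive levels. These orders agree on each
shared level, hence amalgamate into one linear order. It turns the graph into a word of levels in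
which an earlier `x` is adjacent to a later `y` iff `x` is one level above `y`
(`exists_list_pairwise_adj_iff`). Without an induced `P_k` there are at most `k` letters, since
geodesics are induced paths. Higman's lemma then handles connected labelled graphs, and a second
use, on lists of components, handles all of them.

(ii) → (i): Delete a vertex from each bound and label the others by adjacency to it; in an infinite
family, one bound would embed in a non-isomorphic one.

(iii) fails → (i) fails: proper induced subgraphs of a cycle embed in paths, so if all paths are in
the class, every odd cycle is a bound. -/

/-! ### Amalgamation of linear orders -/

/-- A map that is strictly monotone on `T` agrees on `T` with one that is strictly monotone
everywhere. -/
theorem exists_strictMono_extension {V : Type*} [Finite V] (K : V → ℕ)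
    (T : Set V) (φ : V → ℚ) (h : ∀ x ∈ T, ∀ y ∈ T, K x < K y → φ x < φ y) :
    ∃ ψ : V → ℚ, (∀ x ∈ T, ψ x = φ x) ∧ ∀ x y, K x < K y → ψ x < ψ y := by
  classical
  have := Fintype.ofFinite V
  have key : ∀ S : Finset V, ∃ ψ : V → ℚ, (∀ x ∈ T, ψ x = φ x) ∧
      ∀ x, (x ∈ T ∨ x ∈ S) → ∀ y, (y ∈ T ∨ y ∈ S) → K x < K y → ψ x < ψ y := by
    intro S
    induction S using Finset.induction with
    | empty => exact ⟨φ, fun _ _ => rfl, by simpa using h⟩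
    | insert a S _ ih =>
      obtain ⟨ψ, h1, h2⟩ := ih
      by_cases ha : a ∈ T ∨ a ∈ S
      · refine ⟨ψ, h1, fun x hx y hy hxy => h2 x ?_ y ?_ hxy⟩ <;> grind
      · let lo := (Finset.univ.filter fun x => (x ∈ T ∨ x ∈ S) ∧ K x < K a).image ψ
        let hi := (Finset.univ.filter fun x => (x ∈ T ∨ x ∈ S) ∧ K a < K x).image ψ
        -- Density of `ℚ`, without endpoints, leaves room for the value of the new vertex `a`.
        obtain ⟨q, hlo, hhi⟩ := Order.exists_between_finsets lo hi (by
          intro p hp r hr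
          simp only [lo, hi, Finset.mem_image, Finset.mem_filter, Finset.mem_univ, true_and]
            at hp hr
          obtain ⟨x, ⟨hx, hxa⟩, rfl⟩ := hp
          obtain ⟨y, ⟨hy, hya⟩, rfl⟩ := hr
          exact h2 x hx y hy (hxa.trans hya))
        have hlo' : ∀ x, (x ∈ T ∨ x ∈ S) → K x < K a → ψ x < q := fun x hx hxa =>
          hlo _ (Finset.mem_image_of_mem _ (by simp [hx, hxa]))
        have hhi' : ∀ x, (x ∈ T ∨ x ∈ S) → K a < K x → q < ψ x := fun x hx hxa =>
          hhi _ (Finset.mem_image_of_mem _ (by simp [hx, hxa]))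
        refine ⟨Function.update ψ a q, fun x hx => ?_, fun x hx y hy hxy => ?_⟩
        · rw [Function.update_of_ne (by rintro rfl; exact ha (.inl hx)), h1 x hx]
        · have aux : ∀ z, (z ∈ T ∨ z ∈ insert a S) → z ≠ a → (z ∈ T ∨ z ∈ S) := by
            intro z hz hne
            simpa [hne] using hz
          rcases eq_or_ne x a with rfl | hxa <;> rcases eq_or_ne y x with rfl | hyx
          · exact absurd hxy (lt_irrefl _)
          · simpa [Function.update_of_ne hyx] using hhi' y (aux y hy hyx) hxy
          · exact absurd hxy (lt_irrefl _)
          · rcases eq_or_ne y a with rfl | hya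
            · simpa [Function.update_of_ne hxa] using hlo' x (aux x hx hxa) hxy
            · simpa [Function.update_of_ne hxa, Function.update_of_ne hya] using
                h2 x (aux x hx hxa) y (aux y hy hya) hxy
  obtain ⟨ψ, h1, h2⟩ := key Finset.univ
  exact ⟨ψ, h1, fun x y => h2 x (.inr (Finset.mem_univ x)) y (.inr (Finset.mem_univ y))⟩

/-- Amalgamation of linear orders along a path: orders on the unions of consecutive levels, which
agree on every level, are induced by a single map to `ℚ`. -/
theorem exists_amalgamation {V : Type*} [Finite V] (lev : V → ℕ) (K : ℕ → V → ℕ)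
    (hmono : ∀ i x y, lev x = i + 1 → lev y = i + 1 → K (i + 1) x < K (i + 1) y → K i x < K i y) :
    ∃ φ : V → ℚ, ∀ i x y, (lev x = i ∨ lev x = i + 1) → (lev y = i ∨ lev y = i + 1) →
      K i x < K i y → φ x < φ y := by
  have key : ∀ m, ∃ φ : V → ℚ, ∀ i ≤ m, ∀ x y, (lev x = i ∨ lev x = i + 1) →
      (lev y = i ∨ lev y = i + 1) → K i x < K i y → φ x < φ y := by
    intro m
    induction m with
    | zero =>
      refine ⟨fun x => K 0 x, fun i hi x y _ _ hxy => ?_⟩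
      obtain rfl : i = 0 := by omega
      exact Nat.cast_lt.2 hxy
    | succ m ih =>
      obtain ⟨φ, hφ⟩ := ih
      obtain ⟨ψ, h1, h2⟩ := exists_strictMono_extension (K (m + 1)) {x | lev x = m + 1} φ
        (fun x hx y hy hxy => hφ m le_rfl x y (.inr hx) (.inr hy) (hmono m x y hx hy hxy))
      -- The two maps agree on level `m + 1`, the only level where the old and the new constraints
      -- meet.
      refine ⟨fun x => if lev x ≤ m then φ x else ψ x, fun i hi x y hx hy hxy => ?_⟩
      rcases Nat.lt_or_ge m i with him | him
      · obtain rfl : i = m + 1 := by omega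
        have hx' : ¬ lev x ≤ m := by omega
        have hy' : ¬ lev y ≤ m := by omega
        simpa [hx', hy'] using h2 x y hxy
      · have aux : ∀ z, (lev z = i ∨ lev z = i + 1) → (if lev z ≤ m then φ z else ψ z) = φ z := by
          intro z hz
          split_ifs with h
          · rfl
          · exact h1 z (by change lev z = m + 1; omega)
        simpa only [aux x hx, aux y hy] using hφ i him x y hx hy hxy
  obtain ⟨M, hM⟩ := (Set.finite_range lev).bddAbove
  obtain ⟨φ, hφ⟩ := key M
  refine ⟨φ, fun i x y hx hy => hφ i ?_ x y hx hy⟩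
  have := hM (Set.mem_range_self x)
  omega

/-! ### Encoding connected graphs by words of distances -/

theorem SimpleGraph.Connected.exists_adj_dist_eq {V : Type*} {G : SimpleGraph V} (hG : G.Connected)
    {v x : V} {n : ℕ} (h : G.dist v x = n + 1) : ∃ u, G.Adj u x ∧ G.dist v u = n := by
  obtain ⟨p, hp⟩ := hG.exists_walk_length_eq_dist x v
  cases p with
  | nil => simp at h
  | @cons _ u _ hxu q =>
    refine ⟨u, hxu.symm, ?_⟩
    rw [G.dist_comm, h] at hp
    have h1 := G.dist_le q
    have h2 := hxu.symm.diff_dist_adj (u := v)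
    rw [SimpleGraph.Walk.length_cons] at hp
    rw [G.dist_comm] at h1
    omega

/-- A connected triangle-free permutation graph can be encoded by a word in which the letters are
the distances from a fixed vertex. -/
theorem exists_list_pairwise_adj_iff {V : Type*} [Finite V] {G : SimpleGraph V} (hG : G.Connected)
    (pos val : V → ℕ) (hpos : pos.Injective) (hval : val.Injective)
    (hadj : ∀ x y, G.Adj x y ↔ pos x < pos y ∧ val y < val x ∨ pos y < pos x ∧ val x < val y)
    (htri : ∀ x y z, G.Adj x y → G.Adj y z → ¬ G.Adj x z) :
    ∃ (v : V) (l : List V), l.Nodup ∧ (∀ x, x ∈ l) ∧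
      l.Pairwise fun x y => G.Adj x y ↔ G.dist v x = G.dist v y + 1 := by
  classical
  have := hG.nonempty
  obtain ⟨v, hv⟩ := Finite.exists_min pos
  set lev : V → ℕ := fun x => G.dist v x with hlev
  have pred : ∀ n x, lev x = n + 1 → ∃ u, G.Adj u x ∧ lev u = n := fun n x h =>
    hG.exists_adj_dist_eq h
  -- Neighbours on both sides of `x` would be reversed with each other as well, giving a triangle.
  have hA : ∀ x y z, G.Adj x y → pos x < pos y → G.Adj x z → pos x < pos z := by
    intro x y z h1 h2 h3
    have := htri y x z h1.symm h3
    rw [hadj] at h1 h3 this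
    omega
  have hB : ∀ x y z, G.Adj x y → pos y < pos x → G.Adj x z → pos z < pos x := by
    intro x y z h1 h2 h3
    have := htri y x z h1.symm h3
    rw [hadj] at h1 h3 this
    omega
  have side : ∀ n x, lev x = n → (Even n → ∀ z, G.Adj x z → pos x < pos z) ∧
      (¬ Even n → ∀ z, G.Adj x z → pos z < pos x) := by
    intro n
    induction n with
    | zero =>
      intro x hx
      obtain rfl : v = x := hG.dist_eq_zero_iff.1 hx
      refine ⟨fun _ z hz => lt_of_le_of_ne (hv z) fun h => hz.ne (hpos h), fun h => ?_⟩
      simp at h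
    | succ n ih =>
      intro x hx
      obtain ⟨u, hux, hu⟩ := pred n x hx
      obtain ⟨h1, h2⟩ := ih u hu
      rw [Nat.even_add_one, not_not]
      exact ⟨fun hn z hz => hA x u z hux.symm (h2 hn x hux) hz,
        fun hn z hz => hB x u z hux.symm (h1 hn x hux) hz⟩
  have hne : ∀ x y, G.Adj x y → lev x ≠ lev y := by
    intro x y hxy h
    by_cases hn : Even (lev x)
    · exact lt_asymm ((side _ x rfl).1 hn y hxy) ((side _ y h.symm).1 hn x hxy.symm)
    · exact lt_asymm ((side _ x rfl).2 hn y hxy) ((side _ y h.symm).2 hn x hxy.symm)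
  have hdiff : ∀ x y, G.Adj x y → lev x = lev y + 1 ∨ lev y = lev x + 1 := by
    intro x y hxy
    have h1 := hne x y hxy
    have h2 := hxy.diff_dist_adj (u := v)
    simp only [hlev] at h1 ⊢
    omega
  have hlt : ∀ x y, x ≠ y → ¬ G.Adj x y → (pos x < pos y ↔ val x < val y) := by
    intro x y hxy h
    have h1 := hpos.ne hxy
    have h2 := hval.ne hxy
    rw [hadj] at h
    omega
  -- Vertices two levels apart are ordered alike by `pos` and `val`. In the inductive step, `t` and
  -- `y` are non-adjacent; for even `n` this yields `val x < val t < val y`, for odd `n` the same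
  -- with `pos`.
  have two : ∀ n x y, lev x = n → lev y = n + 2 → pos x < pos y ∧ val x < val y := by
    intro n
    induction n with
    | zero =>
      intro x y hx hy
      obtain rfl : v = x := hG.dist_eq_zero_iff.1 hx
      have hxy : v ≠ y := by rintro rfl; omega
      have hp : pos v < pos y := lt_of_le_of_ne (hv y) (hpos.ne hxy)
      exact ⟨hp, (hlt v y hxy fun h => by have := hdiff _ _ h; omega).1 hp⟩
    | succ n ih =>
      intro x y hx hy
      have hxy : x ≠ y := by rintro rfl; omega
      have hnadj : ¬ G.Adj x y := fun h => by have := hdiff _ _ h; omega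
      have hiff := hlt x y hxy hnadj
      have hpne := hpos.ne hxy
      have hvne := hval.ne hxy
      obtain ⟨t, htx, ht⟩ := pred n x hx
      obtain ⟨w, hwy, hw⟩ := pred (n + 2) y hy
      have htw := ih t w ht hw
      have hty : ¬ G.Adj t y := fun h => by have := hdiff _ _ h; omega
      have h1 := side n t ht
      have h2 := side (n + 2) w hw
      have h3 : Even (n + 2) ↔ Even n := by simp [Nat.even_add]
      rw [h3] at h2
      by_cases hn : Even n
      · have h4 := h1.1 hn x htx
        have h5 := h2.1 hn y hwy
        rw [hadj] at htx hwy hty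
        omega
      · have h4 := h1.2 hn x htx
        have h5 := h2.2 hn y hwy
        rw [hadj] at htx hwy hty
        omega
  have one : ∀ n x y, lev x = n → lev y = n + 1 →
      (Even n → pos x < pos y) ∧ (¬ Even n → val x < val y) := by
    intro n x y hx hy
    have hxy : x ≠ y := by rintro rfl; omega
    cases n with
    | zero =>
      obtain rfl : v = x := hG.dist_eq_zero_iff.1 hx
      exact ⟨fun _ => lt_of_le_of_ne (hv y) (hpos.ne hxy), fun h => by simp at h⟩
    | succ n =>
      obtain ⟨t, htx, ht⟩ := pred n x hx
      have h1 := two n t y ht hy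
      refine ⟨fun hn => ?_, fun hn => ?_⟩
      · exact ((side _ x hx).1 hn t htx.symm).trans h1.1
      · have h2 := (side _ x hx).2 hn t htx.symm
        rw [hadj] at htx
        omega
  -- By `one`, one of the two orders is constant between levels `i` and `i + 1`; `K i` is the other
  -- one, which decides adjacency.
  set K : ℕ → V → ℕ := fun i => if Even i then val else pos with hKdef
  have hKinj : ∀ i, (K i).Injective := by
    intro i
    simp only [hKdef]
    split_ifs
    exacts [hval, hpos]
  -- Levels are independent sets, so `pos` and `val` agree on each of them.
  obtain ⟨φ, hφ⟩ := exists_amalgamation lev K (by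
    intro i x y hx hy hxy
    have hne' : x ≠ y := by rintro rfl; exact lt_irrefl _ hxy
    have := hlt x y hne' fun h => hne x y h (hx.trans hy.symm)
    simp only [hKdef, Nat.even_add_one] at hxy ⊢
    split_ifs at hxy ⊢ <;> omega)
  have adjK : ∀ x y, lev y = lev x + 1 → (G.Adj x y ↔ K (lev x) y < K (lev x) x) := by
    intro x y h
    have h1 := one _ x y rfl h
    rw [hadj]
    by_cases hn : Even (lev x)
    · have := h1.1 hn
      simp only [hKdef, hn, if_true]
      omega
    · have := h1.2 hn
      simp only [hKdef, hn, if_false]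
      omega
  have adjφ : ∀ x y, lev y = lev x + 1 →
      (G.Adj x y → φ y < φ x) ∧ (¬ G.Adj x y → φ x < φ y) := by
    intro x y h
    rw [adjK x y h]
    refine ⟨hφ _ y x (.inr h) (.inl rfl), fun hn => hφ _ x y (.inl rfl) (.inr h) ?_⟩
    refine lt_of_le_of_ne (not_lt.1 hn) ((hKinj _).ne ?_)
    rintro rfl
    omega
  have := Fintype.ofFinite V
  let r : V → V → Prop := fun x y => φ x ≤ φ y
  have : Std.Total r := ⟨fun x y => le_total (φ x) (φ y)⟩
  have : IsTrans V r := ⟨fun x y z => le_trans (a := φ x)⟩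
  refine ⟨v, Finset.univ.toList.insertionSort r, ?_, ?_, ?_⟩
  · exact (List.perm_insertionSort r _).nodup_iff.2 (Finset.nodup_toList _)
  · intro x
    exact (List.perm_insertionSort r _).mem_iff.2 (by simp)
  · refine (List.pairwise_insertionSort r _).imp ?_
    intro x y hxy
    change φ x ≤ φ y at hxy
    change _ ↔ lev x = lev y + 1
    constructor
    · intro h
      rcases hdiff x y h with h' | h'
      · exact h'
      · exact absurd ((adjφ x y h').1 h) (not_lt.2 hxy)
    · intro h
      by_contra hn
      exact absurd ((adjφ y x h).2 fun h' => hn h'.symm) (not_lt.2 hxy)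

/-- A vertex at distance `k` yields an induced path on `k + 1` vertices. -/
theorem SimpleGraph.Connected.nonempty_pathGraph_embedding {V : Type*} {G : SimpleGraph V}
    (hG : G.Connected) {v x : V} {k : ℕ} (h : k < G.dist v x + 1) :
    Nonempty (SimpleGraph.pathGraph k ↪g G) := by
  obtain ⟨f, hf⟩ : ∃ f : ℕ → V, ∀ i, i < k →
      G.dist v (f i) = i ∧ (i + 1 < k → G.Adj (f i) (f (i + 1))) := by
    obtain ⟨p, hp⟩ := hG.exists_walk_length_eq_dist v x
    -- Along a geodesic the distance from `v` grows by one at each step, which also excludes chords.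
    have hd : ∀ i ≤ p.length, G.dist v (p.getVert i) = i := by
      intro i hi
      have h1 := G.dist_le (p.take i)
      have h2 := G.dist_le (p.drop i)
      have h3 := hG.dist_triangle (u := v) (v := p.getVert i) (w := x)
      rw [SimpleGraph.Walk.take_length] at h1
      rw [SimpleGraph.Walk.drop_length] at h2
      omega
    exact ⟨p.getVert, fun i hi => ⟨hd i (by omega), fun hi' => p.adj_getVert_succ (by omega)⟩⟩
  have hinj : Function.Injective fun i : Fin k => f i := by
    intro i j hij
    have := congrArg (G.dist v) hij
    rw [(hf i i.2).1, (hf j j.2).1] at this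
    exact Fin.ext this
  refine ⟨⟨⟨fun i => f i, hinj⟩, ?_⟩⟩
  intro i j
  change G.Adj (f i) (f j) ↔ _
  rw [SimpleGraph.pathGraph_adj]
  constructor
  · intro hij
    have h1 := hij.diff_dist_adj (u := v)
    rw [(hf i i.2).1, (hf j j.2).1] at h1
    have h2 : (i : ℕ) ≠ j := fun h => hij.ne (by rw [h])
    omega
  · rintro (h | h)
    · rw [← h]
      exact (hf i i.2).2 (by omega)
    · rw [← h]
      exact ((hf j j.2).2 (by omega)).symm

/-! ### Higman's lemma for components and for words -/

theorem List.SublistForall₂.exists_strictMono {α β : Type*} {R : α → β → Prop} {l₁ : List α}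
    {l₂ : List β} (h : List.SublistForall₂ R l₁ l₂) :
    ∃ f : Fin l₁.length → Fin l₂.length, StrictMono f ∧ ∀ i, R (l₁.get i) (l₂.get (f i)) := by
  obtain ⟨l, hl, hsub⟩ := List.sublistForall₂_iff.1 h
  obtain ⟨f, hf⟩ := List.sublist_iff_exists_fin_orderEmbedding_get_eq.1 hsub
  refine ⟨fun i => f (Fin.cast hl.length_eq i), fun i j hij => f.strictMono hij, fun i => ?_⟩
  rw [← hf]
  exact hl.get i.2 (hl.length_eq ▸ i.2)

namespace LabelledFinGraph

variable {Q : Type v}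

/-- A connected component of a labelled graph. -/
def component (G : LabelledFinGraph.{u, v} Q) (c : G.graph.ConnectedComponent) :
    LabelledFinGraph.{u, v} Q where
  toFinGraph := G.toFinGraph.induced c.supp
  label x := G.label x.1

/-- The connected components of a labelled graph, listed in some order. -/
noncomputable def components (G : LabelledFinGraph.{u, v} Q) :
    List G.graph.ConnectedComponent :=
  (Set.toFinite (Set.univ : Set G.graph.ConnectedComponent)).toFinset.toList

theorem nodup_components (G : LabelledFinGraph.{u, v} Q) : G.components.Nodup :=
  Finset.nodup_toList _

theorem mem_components (G : LabelledFinGraph.{u, v} Q) (c : G.graph.ConnectedComponent) :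
    c ∈ G.components := by
  simp [components]

variable [Preorder Q]

instance isPreorder_embeds :
    IsPreorder (LabelledFinGraph.{u, v} Q) LabelledFinGraph.Embeds where
  refl _ := ⟨SimpleGraph.Embedding.refl, fun _ => le_rfl⟩
  trans _ _ _ := fun ⟨f, hf⟩ ⟨g, hg⟩ => ⟨f.trans g, fun x => (hf x).trans (hg (f x))⟩

/-- Embeddings of the components into pairwise distinct components glue together. -/
theorem embeds_of_component_embeds {G H : LabelledFinGraph.{u, v} Q}
    (F : G.graph.ConnectedComponent → H.graph.ConnectedComponent) (hF : F.Injective)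
    (h : ∀ c, (G.component c).Embeds (H.component (F c))) : G.Embeds H := by
  choose f hf using h
  let mk := G.graph.connectedComponentMk
  let g : G.V → H.V := fun x => (f (mk x) ⟨x, rfl⟩).1
  have hg : ∀ c (x : c.supp), g x.1 = (f c x).1 := by
    rintro _ ⟨x, rfl⟩
    rfl
  have hcomp : ∀ x, H.graph.connectedComponentMk (g x) = F (mk x) := fun x =>
    (f (mk x) ⟨x, rfl⟩).2
  have hinj : g.Injective := by
    intro x y hxy
    have hc : mk x = mk y := hF (by rw [← hcomp, ← hcomp, hxy])
    rw [hg (mk y) ⟨x, hc⟩, hg (mk y) ⟨y, rfl⟩] at hxy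
    exact congrArg Subtype.val ((f (mk y)).injective (Subtype.ext hxy))
  refine ⟨⟨⟨g, hinj⟩, ?_⟩, fun x => hf (mk x) ⟨x, rfl⟩⟩
  intro x y
  change H.graph.Adj (g x) (g y) ↔ G.graph.Adj x y
  by_cases hc : mk x = mk y
  · rw [hg (mk y) ⟨x, hc⟩, hg (mk y) ⟨y, rfl⟩]
    exact (f (mk y)).map_rel_iff (a := ⟨x, hc⟩) (b := ⟨y, rfl⟩)
  · refine iff_of_false (fun h => hc (hF ?_)) fun h => hc ?_
    · rw [← hcomp, ← hcomp]
      exact SimpleGraph.ConnectedComponent.connectedComponentMk_eq_of_adj h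
    · exact SimpleGraph.ConnectedComponent.connectedComponentMk_eq_of_adj h

/-- Graphs whose components are taken from a well-quasi-ordered set are well-quasi-ordered. -/
theorem partiallyWellOrderedOn_of_component {S : Set (LabelledFinGraph.{u, v} Q)}
    (hS : S.PartiallyWellOrderedOn LabelledFinGraph.Embeds) :
    {G : LabelledFinGraph.{u, v} Q | ∀ c, G.component c ∈ S}.PartiallyWellOrderedOn
      LabelledFinGraph.Embeds := by
  rw [Set.partiallyWellOrderedOn_iff_exists_lt]
  intro G hG
  obtain ⟨m, n, hmn, h⟩ := (hS.partiallyWellOrderedOn_sublistForall₂ _).exists_lt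
    (f := fun n => (G n).components.map (G n).component) (by
      intro n H hH
      obtain ⟨c, -, rfl⟩ := List.mem_map.1 hH
      exact hG n c)
  refine ⟨m, n, hmn, ?_⟩
  rw [List.sublistForall₂_map_left_iff, List.sublistForall₂_map_right_iff] at h
  obtain ⟨f, hf, hR⟩ := h.exists_strictMono
  have hget : ∀ c, ∃ i, (G m).components.get i = c := fun c =>
    List.mem_iff_get.1 ((G m).mem_components c)
  choose idx hidx using hget
  refine embeds_of_component_embeds (fun c => (G n).components.get (f (idx c))) ?_ fun c => ?_
  · intro c d hcd
    rw [← hidx c, ← hidx d, hf.injective ((G n).nodup_components.injective_get hcd)]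
  · simpa only [hidx] using hR (idx c)

/-- The word `l` encodes the graph of `G` by means of the letters `lev`. -/
structure IsEncoding (G : LabelledFinGraph.{u, v} Q) (lev : G.V → ℕ) (l : List G.V) : Prop where
  nodup : l.Nodup
  mem : ∀ x, x ∈ l
  pairwise : l.Pairwise fun x y => G.graph.Adj x y ↔ lev x = lev y + 1

/-- Adjacency depends only on the letters of two vertices and their order in the word, so an
order-preserving map that keeps letters is an induced embedding. -/
theorem IsEncoding.embeds {G H : LabelledFinGraph.{u, v} Q} {lev : G.V → ℕ} {l : List G.V}
    {lev' : H.V → ℕ} {l' : List H.V} (hl : G.IsEncoding lev l) (hl' : H.IsEncoding lev' l')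
    (h : List.SublistForall₂ (fun x y => lev x = lev' y ∧ G.label x ≤ H.label y) l l') :
    G.Embeds H := by
  obtain ⟨f, hf, hR⟩ := h.exists_strictMono
  have hget : ∀ x, ∃ i, l.get i = x := fun x => List.mem_iff_get.1 (hl.mem x)
  choose idx hidx using hget
  let g : G.V → H.V := fun x => l'.get (f (idx x))
  have hinj : g.Injective := by
    intro c d hcd
    rw [← hidx c, ← hidx d, hf.injective (hl'.nodup.injective_get hcd)]
  have hlev : ∀ x, lev' (g x) = lev x := fun x => by
    rw [← (hR (idx x)).1, hidx]
  have hlab : ∀ x, G.label x ≤ H.label (g x) := fun x => by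
    simpa only [hidx] using (hR (idx x)).2
  have key : ∀ x y, idx x < idx y → (H.graph.Adj (g x) (g y) ↔ G.graph.Adj x y) := by
    intro x y hxy
    have h1 := List.pairwise_iff_get.1 hl.pairwise _ _ hxy
    have h2 := List.pairwise_iff_get.1 hl'.pairwise _ _ (hf hxy)
    rw [hidx, hidx] at h1
    change H.graph.Adj (g x) (g y) ↔ lev' (g x) = lev' (g y) + 1 at h2
    rw [h1, h2, hlev, hlev]
  refine ⟨⟨⟨g, hinj⟩, ?_⟩, hlab⟩
  intro x y
  change H.graph.Adj (g x) (g y) ↔ G.graph.Adj x y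
  rcases lt_trichotomy (idx x) (idx y) with h | h | h
  · exact key x y h
  · have : x = y := by rw [← hidx x, h, hidx]
    simp [this]
  · rw [H.graph.adj_comm, G.graph.adj_comm]
    exact key y x h

/-- Labelled graphs which are encoded by words over a fixed finite alphabet are
well-quasi-ordered. -/
theorem partiallyWellOrderedOn_isEncoding [WellQuasiOrderedLE Q] (k : ℕ) :
    {G : LabelledFinGraph.{u, v} Q | ∃ lev l, G.IsEncoding lev l ∧ ∀ x, lev x < k}
      |>.PartiallyWellOrderedOn LabelledFinGraph.Embeds := by
  rw [Set.partiallyWellOrderedOn_iff_exists_lt]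
  intro G hG
  choose lev l hl hk using hG
  -- Letters must match exactly, which is still a wqo because there are finitely many.
  have h1 : {i : ℕ | i < k}.PartiallyWellOrderedOn (· = ·) :=
    (Set.finite_lt_nat k).partiallyWellOrderedOn
  have h2 : (Set.univ : Set Q).PartiallyWellOrderedOn (· ≤ ·) :=
    Set.partiallyWellOrderedOn_univ_iff.2 wellQuasiOrdered_le
  have : IsPreorder (ℕ × Q) fun x y => x.1 = y.1 ∧ x.2 ≤ y.2 :=
    { refl := fun _ => ⟨rfl, le_rfl⟩
      trans := fun _ _ _ h h' => ⟨h.1.trans h'.1, h.2.trans h'.2⟩ }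
  obtain ⟨m, n, hmn, h⟩ := ((h1.prod h2).partiallyWellOrderedOn_sublistForall₂ _).exists_lt
    (f := fun n => (l n).map fun x => (lev n x, (G n).label x)) (by
      intro n p hp
      obtain ⟨x, -, rfl⟩ := List.mem_map.1 hp
      exact ⟨hk n x, trivial⟩)
  rw [List.sublistForall₂_map_left_iff, List.sublistForall₂_map_right_iff] at h
  exact ⟨m, n, hmn, (hl m).embeds (hl n) h⟩

end LabelledFinGraph

/-! ### Path-free classes are hereditary wqo -/

/-- The path on `k` vertices as a finite graph. -/
def FinGraph.path (k : ℕ) : FinGraph.{u} where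
  V := ULift.{u} (Fin k)
  finite := inferInstance
  graph := (SimpleGraph.pathGraph k).comap ULift.down

/-- The cycle on `k` vertices as a finite graph. -/
def FinGraph.cycle (k : ℕ) : FinGraph.{u} where
  V := ULift.{u} (Fin k)
  finite := inferInstance
  graph := (SimpleGraph.cycleGraph k).comap ULift.down

theorem IsPathFree.isEmpty_embedding {C : Set FinGraph.{u}} (hC : IsHereditaryClass C) {k : ℕ}
    (h : IsPathFree k C) {G : FinGraph.{u}} (hG : G ∈ C) :
    IsEmpty (SimpleGraph.pathGraph k ↪g G.graph) := by
  refine ⟨fun f => ?_⟩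
  have e : (FinGraph.path.{u} k).graph ≃g SimpleGraph.pathGraph k :=
    ⟨Equiv.ulift, Iff.rfl⟩
  exact h (FinGraph.path k) (hC _ _ hG ⟨e.toEmbedding.trans f⟩) ⟨e⟩

theorem FinGraph.IsBipartitePermutationGraph.exists_list_pairwise_adj_iff {G : FinGraph.{u}}
    (h : G.IsBipartitePermutationGraph) (hG : G.graph.Connected) :
    ∃ (v : G.V) (l : List G.V), l.Nodup ∧ (∀ x, x ∈ l) ∧
      l.Pairwise fun x y => G.graph.Adj x y ↔ G.graph.dist v x = G.graph.dist v y + 1 := by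
  obtain ⟨⟨col⟩, n, σ, ⟨e⟩⟩ := h
  refine _root_.exists_list_pairwise_adj_iff hG (fun x => e x) (fun x => σ (e x))
    (Fin.val_injective.comp e.injective)
    (Fin.val_injective.comp (σ.injective.comp e.injective)) (fun x y => ?_)
    fun x y z hxy hyz hxz => ?_
  · exact e.map_rel_iff.symm
  -- Two colours cannot properly colour a triangle.
  · have h1 := col.valid hxy
    have h2 := col.valid hyz
    have h3 := col.valid hxz
    omega

theorem IsPathFree.isHereditaryWqo {C : Set FinGraph.{u}} (hC : IsHereditaryClass C)
    (hbp : ∀ G ∈ C, G.IsBipartitePermutationGraph) {k : ℕ} (h : IsPathFree k C) :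
    IsHereditaryWqo.{u, v} C := by
  intro Q _ _
  refine (LabelledFinGraph.partiallyWellOrderedOn_of_component
    (LabelledFinGraph.partiallyWellOrderedOn_isEncoding k)).mono fun G hG c => ?_
  have hc : (G.component c).toFinGraph ∈ C :=
    hC _ _ hG ⟨SimpleGraph.Embedding.induce c.supp⟩
  have hconn : (G.component c).graph.Connected := c.connected_toSimpleGraph
  obtain ⟨v, l, h1, h2, h3⟩ := (hbp _ hc).exists_list_pairwise_adj_iff hconn
  refine ⟨(G.component c).graph.dist v, l, ⟨h1, h2, h3⟩, fun x => ?_⟩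
  by_contra hx
  exact (h.isEmpty_embedding hC hc).false
    (hconn.nonempty_pathGraph_embedding (v := v) (x := x) (by omega)).some

/-! ### Hereditary wqo classes have finitely many bounds -/

/-- Bounds of a class which embed in one another are isomorphic. -/
theorem IsBoundOf.nonempty_iso {C : Set FinGraph.{u}} (hC : IsHereditaryClass C)
    {A B : FinGraph.{u}} (hA : IsBoundOf C A) (hB : IsBoundOf C B) (f : A.graph ↪g B.graph) :
    Nonempty (A.graph ≃g B.graph) := by
  have hf : Set.range f = Set.univ := by
    by_contra h
    refine hA.1 (hC _ _ (hB.2 _ h) ⟨⟨⟨fun x => ⟨f x, x, rfl⟩, fun x y hxy => ?_⟩, ?_⟩⟩)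
    · exact f.injective (congrArg Subtype.val hxy)
    · intro x y
      exact f.map_rel_iff
  exact ⟨⟨Equiv.ofBijective f ⟨f.injective, Set.range_eq_univ.1 hf⟩, f.map_rel_iff⟩⟩

/-- Labels for the vertices adjacent, respectively not adjacent, to a deleted vertex. -/
def AdjacencyLabel : Type v := ULift.{v} Prop

instance : Finite AdjacencyLabel.{v} := inferInstanceAs (Finite (ULift.{v} Prop))

/-- Equality as the order forces embeddings to preserve both adjacency and non-adjacency to the
deleted vertex. -/
instance : Preorder AdjacencyLabel.{v} where
  le := (· = ·)
  le_refl _ := rfl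
  le_trans _ _ _ := Eq.trans

theorem IsHereditaryWqo.hasFinitelyManyBounds {C : Set FinGraph.{u}} (hC : IsHereditaryClass C)
    (h : IsHereditaryWqo.{u, v} C) : HasFinitelyManyBounds C := by
  classical
  rcases C.eq_empty_or_nonempty with rfl | ⟨H, hH⟩
  -- The only bound of the empty class is the empty graph; it has no vertex to delete.
  · refine ⟨{FinGraph.path 0}, Set.finite_singleton _, fun B hB => ⟨_, rfl, ?_⟩⟩
    have : IsEmpty B.V := by
      by_contra hne
      rw [not_isEmpty_iff] at hne
      exact hB.2 ∅ Set.empty_ne_univ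
    have : IsEmpty (FinGraph.path.{u} 0).V := inferInstanceAs (IsEmpty (ULift (Fin 0)))
    exact ⟨⟨Equiv.equivOfIsEmpty _ _, fun {a} => isEmptyElim a⟩⟩
  have hne : ∀ B, IsBoundOf C B → Nonempty B.V := by
    intro B hB
    by_contra hemp
    rw [not_nonempty_iff] at hemp
    exact hB.1 (hC _ _ hH ⟨⟨⟨isEmptyElim, fun a => isEmptyElim a⟩, fun {a} => isEmptyElim a⟩⟩)
  let s : Setoid {B // IsBoundOf C B} :=
    { r := fun A B => Nonempty (A.1.graph ≃g B.1.graph)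
      iseqv := ⟨fun _ => ⟨SimpleGraph.Iso.refl⟩, fun ⟨e⟩ => ⟨e.symm⟩,
        fun ⟨e⟩ ⟨e'⟩ => ⟨e.trans e'⟩⟩ }
  rcases finite_or_infinite (Quotient s) with hfin | hinf
  · refine ⟨Set.range fun q : Quotient s => q.out.1, Set.finite_range _, fun B hB => ?_⟩
    exact ⟨_, ⟨Quotient.mk s ⟨B, hB⟩, rfl⟩,
      Quotient.exact (Quotient.out_eq (Quotient.mk s ⟨B, hB⟩)).symm⟩
  exfalso
  let e := Infinite.natEmbedding (Quotient s)
  let B : ℕ → FinGraph.{u} := fun n => (e n).out.1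
  have hB : ∀ n, IsBoundOf C (B n) := fun n => (e n).out.2
  have hiso : ∀ m n, Nonempty ((B m).graph ≃g (B n).graph) → m = n := fun m n hmn =>
    e.injective (by rw [← Quotient.out_eq (e m), ← Quotient.out_eq (e n)]; exact Quotient.sound hmn)
  let x : ∀ n, (B n).V := fun n => (hne _ (hB n)).some
  have : WellQuasiOrderedLE AdjacencyLabel.{v} := Finite.to_wellQuasiOrderedLE
  obtain ⟨m, n, hmn, f, hf⟩ := (h AdjacencyLabel.{v}).exists_lt
    (f := fun n => ⟨(B n).induced {x n}ᶜ, fun y => ⟨(B n).graph.Adj (x n) y.1⟩⟩) (by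
      intro n
      exact (hB n).2 _ fun h => (h ▸ Set.mem_univ (x n) : x n ∈ ({x n}ᶜ : Set (B n).V)) rfl)
  have hlab : ∀ y : ({x m}ᶜ : Set (B m).V),
      (B m).graph.Adj (x m) y.1 ↔ (B n).graph.Adj (x n) (f y).1 := fun y =>
    iff_of_eq (congrArg ULift.down (hf y))
  have hfadj : ∀ y z : ({x m}ᶜ : Set (B m).V),
      (B n).graph.Adj (f y).1 (f z).1 ↔ (B m).graph.Adj y.1 z.1 := fun y z =>
    f.map_rel_iff (a := y) (b := z)
  have hfne : ∀ y, (f y).1 ≠ x n := fun y => (f y).2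
  -- The embedding extends by sending one deleted vertex to the other.
  let g : (B m).V → (B n).V := fun y => if hy : y = x m then x n else (f ⟨y, hy⟩).1
  have hgx : g (x m) = x n := dif_pos rfl
  have hgf : ∀ y (hy : y ≠ x m), g y = (f ⟨y, hy⟩).1 := fun y hy => dif_neg hy
  have hinj : g.Injective := by
    intro y z hyz
    by_cases hy : y = x m <;> by_cases hz : z = x m
    · rw [hy, hz]
    · subst hy
      rw [hgx, hgf z hz] at hyz
      exact absurd hyz.symm (hfne _)
    · subst hz
      rw [hgx, hgf y hy] at hyz
      exact absurd hyz (hfne _)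
    · rw [hgf y hy, hgf z hz] at hyz
      exact congrArg Subtype.val (f.injective (Subtype.ext hyz))
  refine hmn.ne (hiso m n ((hB m).nonempty_iso hC (hB n) ⟨⟨g, hinj⟩, ?_⟩))
  intro y z
  change (B n).graph.Adj (g y) (g z) ↔ (B m).graph.Adj y z
  by_cases hy : y = x m <;> by_cases hz : z = x m
  · simp [hy, hz]
  · rw [hy, hgx, hgf z hz]
    exact (hlab ⟨z, hz⟩).symm
  · rw [hz, hgx, hgf y hy, (B n).graph.adj_comm, (B m).graph.adj_comm]
    exact (hlab ⟨y, hy⟩).symm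
  · rw [hgf y hy, hgf z hz]
    exact hfadj ⟨y, hy⟩ ⟨z, hz⟩

/-! ### Odd cycles as bounds -/

/-- Rotating a missing vertex `v` to the last position, by `a ↦ a - v - 1`, cuts the cycle there:
the remaining vertices see no wrap-around. -/
theorem FinGraph.cycle_induced_embeds_path {n : ℕ} {s : Set (FinGraph.cycle.{u} (n + 2)).V}
    (hs : s ≠ Set.univ) :
    ((FinGraph.cycle.{u} (n + 2)).induced s).Embeds (FinGraph.path (n + 2)) := by
  obtain ⟨⟨v⟩, hv⟩ := (Set.ne_univ_iff_exists_notMem s).1 hs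
  have hlast : ∀ a : Fin (n + 2), ⟨a⟩ ∈ s → (a - v - 1).val < n + 1 := by
    intro a ha
    have h1 : a - v - 1 ≠ Fin.last (n + 1) := by
      intro h
      have h2 : Fin.last (n + 1) + 1 = 0 := Fin.last_add_one _
      rw [← h, sub_add_cancel, sub_eq_zero] at h2
      exact hv (h2 ▸ ha)
    have h2 := (a - v - 1).2
    have h3 := Fin.val_ne_of_ne h1
    simp only [Fin.val_last] at h3
    omega
  have step : ∀ a b : Fin (n + 2), ⟨a⟩ ∈ s → ⟨b⟩ ∈ s →
      (a - b = 1 ↔ (b - v - 1).val + 1 = (a - v - 1).val) := by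
    intro a b ha hb
    have h1 : a - b = 1 ↔ (b - v - 1) + 1 = a - v - 1 := by
      rw [sub_add_cancel, sub_sub, eq_sub_iff_add_eq, sub_eq_iff_eq_add]
      constructor
      · rintro rfl
        abel
      · intro h
        have := congrArg (· - v) h
        rw [← sub_eq_zero] at this ⊢
        rw [← neg_eq_zero, ← this]
        abel
    have h2 : ((b - v - 1) + 1).val = (b - v - 1).val + 1 :=
      Fin.val_add_one_of_lt (Fin.lt_def.2 (hlast b hb))
    rw [h1, Fin.ext_iff, h2]
  refine ⟨⟨⟨fun x => ⟨x.1.down - v - 1⟩, fun x y hxy => ?_⟩, ?_⟩⟩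
  · have h := congrArg ULift.down hxy
    simp only [sub_left_inj] at h
    exact Subtype.ext (ULift.ext _ _ h)
  · rintro ⟨⟨a⟩, ha⟩ ⟨⟨b⟩, hb⟩
    change (SimpleGraph.pathGraph (n + 2)).Adj (a - v - 1) (b - v - 1) ↔
      (SimpleGraph.cycleGraph (n + 2)).Adj a b
    rw [SimpleGraph.pathGraph_adj, SimpleGraph.cycleGraph_adj, step a b ha hb, step b a hb ha,
      or_comm]

/-- In a class of bipartite graphs that contains all paths, all odd cycles are bounds. -/
theorem isBoundOf_cycle {C : Set FinGraph.{u}} (hC : IsHereditaryClass C)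
    (hbp : ∀ G ∈ C, G.graph.IsBipartite) (h : ∀ k, FinGraph.path k ∈ C) {n : ℕ} (hn : Odd n) :
    IsBoundOf C (FinGraph.cycle (n + 2)) := by
  refine ⟨fun hmem => ?_, fun s hs => hC _ _ (h _) (FinGraph.cycle_induced_embeds_path hs)⟩
  have e : SimpleGraph.cycleGraph (n + 2) ≃g (FinGraph.cycle.{u} (n + 2)).graph :=
    ⟨Equiv.ulift.symm, Iff.rfl⟩
  have h1 : (SimpleGraph.cycleGraph (n + 2)).Colorable 2 := (hbp _ hmem).of_hom e.toHom
  have h2 := h1.chromaticNumber_le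
  rw [SimpleGraph.chromaticNumber_cycleGraph_of_odd _ (by omega) (by
    simpa [Nat.odd_add] using hn)] at h2
  exact absurd h2 (by decide)

theorem HasFinitelyManyBounds.exists_isPathFree {C : Set FinGraph.{u}} (hC : IsHereditaryClass C)
    (hbp : ∀ G ∈ C, G.graph.IsBipartite) (h : HasFinitelyManyBounds C) :
    ∃ k, IsPathFree k C := by
  by_contra! hk
  have hpath : ∀ k, FinGraph.path k ∈ C := by
    intro k
    have := hk k
    simp only [IsPathFree, not_forall, not_not] at this
    obtain ⟨G, hG, ⟨e⟩⟩ := this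
    have e' : (FinGraph.path.{u} k).graph ≃g SimpleGraph.pathGraph k := ⟨Equiv.ulift, Iff.rfl⟩
    exact hC _ _ hG ⟨SimpleGraph.Iso.toEmbedding (e'.trans e.symm)⟩
  obtain ⟨S, hS, hB⟩ := h
  obtain ⟨M, hM⟩ := (hS.image fun G : FinGraph.{u} => Nat.card G.V).bddAbove
  -- An odd cycle on `2 * M + 3` vertices, more than any graph in `S` has.
  obtain ⟨B, hBS, ⟨e⟩⟩ := hB _ (isBoundOf_cycle hC hbp hpath (n := 2 * M + 1) ⟨M, rfl⟩)
  have h1 : Nat.card B.V ≤ M := hM (Set.mem_image_of_mem _ hBS)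
  rw [← Nat.card_congr e.toEquiv] at h1
  have h2 : Nat.card (FinGraph.cycle.{u} (2 * M + 1 + 2)).V = 2 * M + 1 + 2 := by
    simp [FinGraph.cycle]
  omega

theorem mainTheorem8 (C : Set FinGraph.{u}) (hC : IsHereditaryClass C)
    (hbp : ∀ G ∈ C, G.IsBipartitePermutationGraph) :
    List.TFAE [HasFinitelyManyBounds C, IsHereditaryWqo.{u, v} C, ∃ k : ℕ, IsPathFree k C] := by
  tfae_have 1 → 3 := fun h => h.exists_isPathFree hC fun G hG => (hbp G hG).1
  tfae_have 3 → 2 := fun ⟨_, h⟩ => h.isHereditaryWqo hC hbp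
  tfae_have 2 → 1 := fun h => h.hasFinitelyManyBounds hC
  tfae_finish
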